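/- Assume that for every $m\in\mathbb N$, every hermitian $m\times m$ complex matrix $A$ and every positive semidefinite $m\times m$ complex matrix $B$, the function $\lambda\mapsto \operatorname{Tr} e^{A-\lambda B}$, $\lambda\in\mathbb R$, is the Laplace transform of a positive measure supported in $[0,\infty)$; that is, there is a positive measure $\mu$ on $[0,\infty)$ such that for every $\lambda\in\mathbb R$ the integral $\int_{[0,\infty)} e^{-\lambda t}\,d\mu(t)$ is finite and equals $\operatorname{Tr} e^{A-\lambda B}$. For an $n\times n$ complex matrix $M$ with eigenvalues $\lambda_1,\dots,\lambda_n$ (counted with algebraic multiplicity) and $1\le j\le n$, let $e_j(M)=\sum_{1\le i_1<\dots<i_j\le n}\lambda_{i_1}\cdots\lambda_{i_j}$. Then for every $n$, every hermitian $n\times n$ complex matrix $A$, every positive semidefinite $n\times n$ complex matrix $B$ and every $1\le j\le n$: (a) For every $k\ge 1$, the integral $$\int_{s_i\ge 0,\ \sum_{i=1}^{k+1}s_i=1} e_j\left(e^{s_1A}Be^{s_2A}B\cdots Be^{s_{k+1}A}\right)ds_1\cdots ds_{k+1}$$ converges, is real and is $\ge 0$. Here the integral over the simplex is the Lebesgue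 integral over $\{(s_1,\dots,s_k): s_i\ge 0,\ \sum_{i=1}^k s_i\le 1\}$ with $s_{k+1}=1-\sum_{i=1}^k s_i$. (b) The function $\lambda\mapsto e_j\left(e^{A-\lambda B}\right)$, $\lambda\in\mathbb R$, is the Laplace transform of a positive measure supported in $[0,\infty)$, in the same sense as above. -/

import Mathlib

open MeasureTheory
open scoped ComplexOrder

noncomputable section

/-- `F : ℝ → ℂ` is the Laplace transform of a positive measure supported in `[0, ∞)`: the integrals
`∫ e^{-l t} dμ(t)` converge and equal `F l` (in particular `F l` is real) for every real `l`. -/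
def IsLaplaceTransform (F : ℝ → ℂ) : Prop :=
  ∃ μ : Measure ℝ, μ (Set.Iio 0) = 0 ∧
    ∀ l : ℝ, Integrable (fun t : ℝ => Real.exp (-(l * t))) μ ∧
      F l = ((∫ t : ℝ, Real.exp (-(l * t)) ∂μ : ℝ) : ℂ)

/-- The Bessis-Moussa-Villani property for `n × n` matrices: for all hermitian `A` and positive
(semidefinite) `B`, `l ↦ Tr exp (A - l B)` is the Laplace transform of a positive measure
supported in `[0, ∞)`. -/
def BMVProperty (n : ℕ) : Prop :=
  ∀ A B : Matrix (Fin n) (Fin n) ℂ, A.IsHermitian → B.PosSemidef →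
    IsLaplaceTransform fun l : ℝ => (NormedSpace.exp (A - l • B)).trace

/-- The `j`-th elementary symmetric function of the eigenvalues of a complex matrix, the
eigenvalues being counted with algebraic multiplicity. -/
def eigenEsymm {n : ℕ} (j : ℕ) (M : Matrix (Fin n) (Fin n) ℂ) : ℂ :=
  M.charpoly.roots.esymm j

/-- The product `e^{s₀ A} B e^{s₁ A} B ⋯ B e^{s_k A}`. -/
def expWord {n k : ℕ} (A B : Matrix (Fin n) (Fin n) ℂ) (s : Fin (k + 1) → ℝ) :
    Matrix (Fin n) (Fin n) ℂ :=
  NormedSpace.exp (s 0 • A) *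
    (List.ofFn fun i : Fin k => B * NormedSpace.exp (s i.succ • A)).prod

/-- The simplex `{s₁, …, s_{k+1} ≥ 0, ∑ sᵢ = 1}` in the coordinates `s₁, …, s_k`. -/
def solidSimplex (k : ℕ) : Set (Fin k → ℝ) :=
  {s | (∀ i, 0 ≤ s i) ∧ ∑ i, s i ≤ 1}

/-- All `k + 1` simplex coordinates from the first `k`: the last one is `1 - ∑ sᵢ`. -/
def simplexPoint {k : ℕ} (s : Fin k → ℝ) : Fin (k + 1) → ℝ :=
  Fin.snoc (α := fun _ => ℝ) s (1 - ∑ i, s i)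

end

/-! ### Tensor powers, permutations of the factors, and the antisymmetrizer -/

section TensorPower

open Matrix

/-! The number e_j(M) is the trace of the j-th exterior power C(M). The map C is multiplicative and
C(e^M) = e^{D(M)}, where D is the linear derivation induced by M. Moreover D preserves hermitian
matrices, and C and D both preserve positive semidefinite ones (`exists_compound`). Hence
e_j(e^{A-λB}) = Tr e^{D(A)-λD(B)}, and (b) is the trace hypothesis for the pair D(A), D(B).

For (a), C carries the word in A, B to the same word in D(A), C(B) (`map_expWord`), so the case of
the trace suffices. The simplex integral of words with k letters B is the coefficient of x^k in
e^{A+xB} (`setIntegral_algWord_eq_dysonTerm`). If Tr e^{A+xB} = ∫ e^{xt} dμ(t), the trace of that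
coefficient is ∫ t^k dμ / k!, which is nonnegative because μ lives on [0,∞)
(`map_dysonTerm_nonneg`).

The exterior power is realised as the range of the antisymmetrizer P in the tensor power. Writing P
= V Vᴴ with Vᴴ V = 1 turns operators on that range into m × m matrices, to which the hypothesis
applies. -/

open scoped MatrixOrder Matrix.Norms.L2Operator in
theorem Matrix.PosSemidef.exists_eq_conjTranspose_mul_self {ι : Type*} [Fintype ι] [DecidableEq ι]
    {M : Matrix ι ι ℂ} (hM : M.PosSemidef) : ∃ C : Matrix ι ι ℂ, M = Cᴴ * C :=
  CStarAlgebra.nonneg_iff_eq_star_mul_self.mp hM.nonneg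

set_option linter.unusedSectionVars false

variable {ι κ : Type*} [Fintype ι] [DecidableEq ι] [Fintype κ] [DecidableEq κ]

/-- The tensor product `⨂ₖ M k` of a family of matrices, as a matrix indexed by functions. -/
def tensorProd (M : κ → Matrix ι ι ℂ) : Matrix (κ → ι) (κ → ι) ℂ :=
  Matrix.of fun f g => ∏ k, M k (f k) (g k)

theorem tensorProd_apply (M : κ → Matrix ι ι ℂ) (f g : κ → ι) :
    tensorProd M f g = ∏ k, M k (f k) (g k) := rfl

theorem tensorProd_mul (M N : κ → Matrix ι ι ℂ) :
    tensorProd (M * N) = tensorProd M * tensorProd N := by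
  ext f g
  simp only [tensorProd_apply, Matrix.mul_apply, Pi.mul_apply, ← Finset.prod_mul_distrib]
  rw [Finset.prod_univ_sum]
  simp

theorem tensorProd_one : tensorProd (1 : κ → Matrix ι ι ℂ) = 1 := by
  ext f g
  simp only [tensorProd_apply, Pi.one_apply, Matrix.one_apply]
  by_cases h : f = g
  · simp [h]
  · obtain ⟨k, hk⟩ := Function.ne_iff.mp h
    rw [if_neg h]
    exact Finset.prod_eq_zero (Finset.mem_univ k) (by simp [hk])

/-- `tensorProd` as a monoid homomorphism. -/
def tensorHom (ι κ : Type*) [Fintype ι] [DecidableEq ι] [Fintype κ] [DecidableEq κ] :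
    (κ → Matrix ι ι ℂ) →* Matrix (κ → ι) (κ → ι) ℂ where
  toFun := tensorProd
  map_one' := tensorProd_one
  map_mul' := tensorProd_mul

theorem conjTranspose_tensorProd (M : κ → Matrix ι ι ℂ) :
    (tensorProd M)ᴴ = tensorProd fun k => (M k)ᴴ := by
  ext f g
  simp [tensorProd_apply, Matrix.conjTranspose_apply]

theorem tensorProd_mulSingle_apply (k : κ) (M : Matrix ι ι ℂ) (f g : κ → ι) :
    tensorProd (Pi.mulSingle k M) f g =
      M (f k) (g k) * ∏ l ∈ {k}ᶜ, (1 : Matrix ι ι ℂ) (f l) (g l) := by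
  rw [tensorProd_apply, Fintype.prod_eq_mul_prod_compl k, Pi.mulSingle_eq_same]
  congr 1
  refine Finset.prod_congr rfl fun l hl => ?_
  rw [Pi.mulSingle_eq_of_ne (by simpa using hl)]

/-- The embedding `M ↦ 1 ⊗ ⋯ ⊗ M ⊗ ⋯ ⊗ 1` with `M` at position `k`. -/
def tensorLeg (ι : Type*) {κ : Type*} [Fintype ι] [DecidableEq ι] [Fintype κ] [DecidableEq κ]
    (k : κ) : Matrix ι ι ℂ →ₐ[ℂ] Matrix (κ → ι) (κ → ι) ℂ :=
  AlgHom.ofLinearMap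
    { toFun := fun M => tensorProd (Pi.mulSingle k M)
      map_add' := fun M N => by
        ext f g; simp only [tensorProd_mulSingle_apply, Matrix.add_apply, add_mul]
      map_smul' := fun c M => by
        ext f g
        simp only [tensorProd_mulSingle_apply, Matrix.smul_apply, smul_eq_mul, mul_assoc,
          RingHom.id_apply] }
    (by simp [tensorProd_one])
    (fun M N => by simp [Pi.mulSingle_mul, tensorProd_mul])

theorem tensorLeg_apply (k : κ) (M : Matrix ι ι ℂ) :
    tensorLeg ι k M = tensorProd (Pi.mulSingle k M) := rfl

theorem conjTranspose_tensorLeg (k : κ) (M : Matrix ι ι ℂ) :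
    (tensorLeg ι k M)ᴴ = tensorLeg ι k Mᴴ := by
  rw [tensorLeg_apply, tensorLeg_apply, conjTranspose_tensorProd]
  congr 1
  ext1 l
  rcases eq_or_ne l k with rfl | h
  · simp
  · simp [Pi.mulSingle_eq_of_ne h]

theorem continuous_tensorLeg (k : κ) : Continuous (tensorLeg ι k) :=
  (tensorLeg ι k).toLinearMap.continuous_of_finiteDimensional

theorem tensorLeg_commute {k l : κ} (h : k ≠ l) (M N : Matrix ι ι ℂ) :
    Commute (tensorLeg ι k M) (tensorLeg ι l N) := by
  rw [Commute, SemiconjBy, tensorLeg_apply, tensorLeg_apply, ← tensorProd_mul, ← tensorProd_mul]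
  exact congrArg tensorProd (Pi.mulSingle_commute (f := fun _ => Matrix ι ι ℂ) h M N).eq

open scoped Matrix.Norms.Operator in
theorem tensorLeg_exp (k : κ) (M : Matrix ι ι ℂ) :
    tensorLeg ι k (NormedSpace.exp M) = NormedSpace.exp (tensorLeg ι k M) :=
  NormedSpace.map_exp (tensorLeg ι k) (continuous_tensorLeg k) M

/-- The derivation `∑ₖ 1 ⊗ ⋯ ⊗ M ⊗ ⋯ ⊗ 1` on the tensor power. -/
def tensorDeriv (ι κ : Type*) [Fintype ι] [DecidableEq ι] [Fintype κ] [DecidableEq κ] :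
    Matrix ι ι ℂ →ₗ[ℂ] Matrix (κ → ι) (κ → ι) ℂ :=
  ∑ k, (tensorLeg ι k).toLinearMap

theorem tensorDeriv_apply (M : Matrix ι ι ℂ) :
    tensorDeriv ι κ M = ∑ k, tensorLeg ι k M := by
  simp [tensorDeriv]

/-- The legs commute, so the exponential of their sum is the product of the legs of e^M, one in each
position. -/
theorem exp_tensorDeriv (M : Matrix ι ι ℂ) :
    NormedSpace.exp (tensorDeriv ι κ M) = tensorProd fun _ => NormedSpace.exp M := by
  rw [tensorDeriv_apply, Matrix.exp_sum_of_commute]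
  · simp only [← tensorLeg_exp]
    have h := congrArg (tensorHom ι κ)
      (Finset.noncommProd_mulSingle fun _ : κ => NormedSpace.exp M)
    exact (Finset.map_noncommProd _ _ _ (tensorHom ι κ)).symm.trans h
  · intro k _ l _ hkl
    exact tensorLeg_commute hkl M M

theorem isHermitian_tensorDeriv {M : Matrix ι ι ℂ} (hM : M.IsHermitian) :
    (tensorDeriv ι κ M).IsHermitian := by
  rw [Matrix.IsHermitian, tensorDeriv_apply, Matrix.conjTranspose_sum]
  simp only [conjTranspose_tensorLeg, hM.eq]

/-- Each leg is a *-homomorphism, so M = Cᴴ C makes every summand of the form Xᴴ X. -/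
theorem posSemidef_tensorDeriv {M : Matrix ι ι ℂ} (hM : M.PosSemidef) :
    (tensorDeriv ι κ M).PosSemidef := by
  obtain ⟨C, rfl⟩ := hM.exists_eq_conjTranspose_mul_self
  rw [tensorDeriv_apply]
  refine Matrix.posSemidef_sum _ fun k _ => ?_
  rw [map_mul, ← conjTranspose_tensorLeg]
  exact Matrix.posSemidef_conjTranspose_mul_self _

theorem posSemidef_tensorProd {M : Matrix ι ι ℂ} (hM : M.PosSemidef) :
    (tensorProd fun _ : κ => M).PosSemidef := by
  obtain ⟨C, rfl⟩ := hM.exists_eq_conjTranspose_mul_self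
  have : (tensorProd fun _ : κ => Cᴴ * C) =
      (tensorProd fun _ : κ => C)ᴴ * tensorProd fun _ => C := by
    rw [conjTranspose_tensorProd, ← tensorProd_mul]; rfl
  rw [this]
  exact Matrix.posSemidef_conjTranspose_mul_self _

/-- The matrix permuting the tensor factors by `σ`. -/
def tensorPerm (ι : Type*) {κ : Type*} [Fintype ι] [DecidableEq ι] [Fintype κ] [DecidableEq κ]
    (σ : Equiv.Perm κ) : Matrix (κ → ι) (κ → ι) ℂ :=
  Matrix.of fun f g => if f ∘ σ = g then 1 else 0

theorem tensorPerm_mul_apply (σ : Equiv.Perm κ) (X : Matrix (κ → ι) (κ → ι) ℂ) (f g : κ → ι) :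
    (tensorPerm ι σ * X) f g = X (f ∘ σ) g := by
  simp [tensorPerm, Matrix.mul_apply]

theorem mul_tensorPerm_apply (σ : Equiv.Perm κ) (X : Matrix (κ → ι) (κ → ι) ℂ) (f g : κ → ι) :
    (X * tensorPerm ι σ) f g = X f (g ∘ σ.symm) := by
  have : ∀ h : κ → ι, h ∘ σ = g ↔ h = g ∘ σ.symm := fun h =>
    (Equiv.eq_comp_symm σ h g).symm
  simp [tensorPerm, Matrix.mul_apply, this]

theorem tensorPerm_mul (σ τ : Equiv.Perm κ) :
    tensorPerm ι σ * tensorPerm ι τ = tensorPerm ι (σ * τ) := by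
  ext f g
  rw [tensorPerm_mul_apply]
  rfl

theorem conjTranspose_tensorPerm (σ : Equiv.Perm κ) :
    (tensorPerm ι σ)ᴴ = tensorPerm ι σ⁻¹ := by
  ext f g
  have : g ∘ σ = f ↔ f ∘ σ.symm = g :=
    ⟨fun h => by rw [← h]; ext; simp, fun h => by rw [← h]; ext; simp⟩
  simp only [tensorPerm, Matrix.conjTranspose_apply, Matrix.of_apply, this, Equiv.Perm.inv_def]
  split_ifs <;> simp

theorem tensorPerm_mul_tensorProd (σ : Equiv.Perm κ) (M : κ → Matrix ι ι ℂ) :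
    tensorPerm ι σ * tensorProd M = tensorProd (M ∘ σ.symm) * tensorPerm ι σ := by
  ext f g
  rw [tensorPerm_mul_apply, mul_tensorPerm_apply, tensorProd_apply, tensorProd_apply,
    ← Equiv.prod_comp σ.symm]
  simp

/-- Moving σ past the leg at k turns it into the leg at σ k; the sum over all legs is unchanged. -/
theorem tensorPerm_commute_tensorDeriv (σ : Equiv.Perm κ) (M : Matrix ι ι ℂ) :
    Commute (tensorPerm ι σ) (tensorDeriv ι κ M) := by
  rw [Commute, SemiconjBy, tensorDeriv_apply, Finset.mul_sum, Finset.sum_mul,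
    ← Equiv.sum_comp σ fun k => tensorLeg ι k M * tensorPerm ι σ]
  refine Finset.sum_congr rfl fun k _ => ?_
  rw [tensorLeg_apply, tensorPerm_mul_tensorProd, tensorLeg_apply]
  congr 2
  ext1 l
  by_cases h : l = σ k
  · subst h; simp
  · have h' : σ.symm l ≠ k := fun e => h (by simp [← e])
    simp [Pi.mulSingle_eq_of_ne h, Pi.mulSingle_eq_of_ne h']

/-- The orthogonal projection onto the antisymmetric tensors. -/
noncomputable def antisymmetrizer (ι κ : Type*) [Fintype ι] [DecidableEq ι] [Fintype κ] [DecidableEq κ] :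
    Matrix (κ → ι) (κ → ι) ℂ :=
  ((Fintype.card κ).factorial : ℂ)⁻¹ •
    ∑ σ : Equiv.Perm κ, ((Equiv.Perm.sign σ : ℤ) : ℂ) • tensorPerm ι σ

theorem isHermitian_antisymmetrizer : (antisymmetrizer ι κ).IsHermitian := by
  rw [Matrix.IsHermitian, antisymmetrizer, Matrix.conjTranspose_smul, Matrix.conjTranspose_sum]
  congr 1
  · simp
  · rw [← Equiv.sum_comp (Equiv.inv (Equiv.Perm κ))]
    refine Finset.sum_congr rfl fun σ _ => ?_
    simp [Matrix.conjTranspose_smul, conjTranspose_tensorPerm]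

theorem tensorPerm_mul_antisymmetrizer (σ : Equiv.Perm κ) :
    tensorPerm ι σ * antisymmetrizer ι κ =
      ((Equiv.Perm.sign σ : ℤ) : ℂ) • antisymmetrizer ι κ := by
  rw [antisymmetrizer, Matrix.mul_smul, smul_comm _ ((Fintype.card κ).factorial : ℂ)⁻¹,
    Finset.mul_sum]
  congr 1
  rw [Finset.smul_sum, ← Equiv.sum_comp (Equiv.mulLeft σ) fun τ : Equiv.Perm κ =>
    ((Equiv.Perm.sign σ : ℤ) : ℂ) • ((Equiv.Perm.sign τ : ℤ) : ℂ) • tensorPerm ι τ]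
  refine Finset.sum_congr rfl fun τ _ => ?_
  rw [Matrix.mul_smul, tensorPerm_mul, smul_smul, Equiv.coe_mulLeft]
  congr 1
  rw [Equiv.Perm.sign_mul, ← Int.cast_mul, Units.val_mul, ← mul_assoc, ← Units.val_mul,
    Int.units_mul_self]
  simp

theorem isIdempotentElem_antisymmetrizer : IsIdempotentElem (antisymmetrizer ι κ) := by
  rw [IsIdempotentElem]
  nth_rw 1 [antisymmetrizer]
  rw [Matrix.smul_mul, Finset.sum_mul]
  have : ∀ σ : Equiv.Perm κ, (((Equiv.Perm.sign σ : ℤ) : ℂ) • tensorPerm ι σ) *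
      antisymmetrizer ι κ = antisymmetrizer ι κ := fun σ => by
    rw [Matrix.smul_mul, tensorPerm_mul_antisymmetrizer, smul_smul, ← Int.cast_mul,
      ← Units.val_mul, Int.units_mul_self]
    simp
  simp only [this, Finset.sum_const, Finset.card_univ, Fintype.card_perm]
  rw [← Nat.cast_smul_eq_nsmul ℂ, smul_smul, inv_mul_cancel₀ (by positivity), one_smul]

theorem antisymmetrizer_commute_tensorProd (M : Matrix ι ι ℂ) :
    Commute (antisymmetrizer ι κ) (tensorProd fun _ => M) := by
  have h : ∀ σ, Commute (tensorPerm ι σ) (tensorProd fun _ : κ => M) := fun σ => by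
    rw [Commute, SemiconjBy, tensorPerm_mul_tensorProd]
    rfl
  exact Commute.smul_left (Commute.sum_left _ _ _ fun σ _ => Commute.smul_left (h σ) _) _

theorem antisymmetrizer_commute_tensorDeriv (M : Matrix ι ι ℂ) :
    Commute (antisymmetrizer ι κ) (tensorDeriv ι κ M) :=
  Commute.smul_left (Commute.sum_left _ _ _ fun σ _ =>
    Commute.smul_left (tensorPerm_commute_tensorDeriv σ M) _) _

/-- The signed sum over σ of the diagonal entries at f is the Leibniz formula for the minor with
rows and columns f. -/
theorem trace_antisymmetrizer_mul_tensorProd (M : Matrix ι ι ℂ) :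
    (antisymmetrizer ι κ * tensorProd fun _ => M).trace =
      ((Fintype.card κ).factorial : ℂ)⁻¹ * ∑ f : κ → ι, (M.submatrix f f).det := by
  rw [antisymmetrizer, Matrix.smul_mul, Matrix.trace_smul, smul_eq_mul, Finset.sum_mul,
    Matrix.trace_sum]
  congr 1
  have h : ∀ σ : Equiv.Perm κ, ((((Equiv.Perm.sign σ : ℤ) : ℂ) • tensorPerm ι σ) *
      tensorProd fun _ => M).trace =
      ∑ f : κ → ι, ((Equiv.Perm.sign σ : ℤ) : ℂ) * ∏ k, M (f (σ k)) (f k) := fun σ => by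
    rw [Matrix.smul_mul, Matrix.trace_smul, smul_eq_mul, Matrix.trace, Finset.mul_sum]
    simp only [Matrix.diag_apply, tensorPerm_mul_apply, tensorProd_apply, Function.comp_apply]
  simp only [h, Matrix.det_apply, Units.smul_def, zsmul_eq_mul, Matrix.submatrix_apply]
  exact Finset.sum_comm

/-- By cardinality such maps are exactly the bijections onto S; their number cancels the factorial
in `antisymmetrizer`. -/
theorem card_filter_image_eq (S : Finset ι) (hS : S.card = Fintype.card κ) :
    (Finset.univ.filter fun f : κ → ι => Finset.univ.image f = S).card =
      (Fintype.card κ).factorial := by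
  have e : κ ≃ S := Fintype.equivOfCardEq (by simp [hS])
  rw [← Fintype.card_equiv e, ← Finset.card_univ,
    ← Finset.card_image_of_injective (f := fun (e : κ ≃ S) (k : κ) => (e k : ι))]
  · congr 1
    ext f
    simp only [Finset.mem_filter, Finset.mem_univ, true_and, Finset.mem_image]
    constructor
    · intro hf
      have hmem : ∀ k, f k ∈ S := fun k => hf ▸ Finset.mem_image_of_mem f (Finset.mem_univ k)
      refine ⟨Equiv.ofBijective (fun k => ⟨f k, hmem k⟩) ?_, rfl⟩
      refine (Fintype.bijective_iff_surjective_and_card _).mpr ⟨?_, by simp [hS]⟩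
      rintro ⟨x, hx⟩
      rw [← hf] at hx
      obtain ⟨k, -, rfl⟩ := Finset.mem_image.mp hx
      exact ⟨k, rfl⟩
    · rintro ⟨e, rfl⟩
      ext x
      simp only [Finset.mem_image, Finset.mem_univ, true_and]
      exact ⟨fun ⟨k, hk⟩ => hk ▸ (e k).2, fun hx => ⟨e.symm ⟨x, hx⟩, by simp⟩⟩
  · intro e e' h
    ext k
    exact congrFun h k

/-- Grouping by image: an injective f reindexes the principal minor on its image, and any other f
repeats a row. -/
theorem sum_det_submatrix_eq (M : Matrix ι ι ℂ) :
    ∑ f : κ → ι, (M.submatrix f f).det = ((Fintype.card κ).factorial : ℂ) *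
      ∑ S ∈ Finset.univ.powersetCard (Fintype.card κ),
        (M.submatrix (Subtype.val : S → ι) (Subtype.val : S → ι)).det := by
  rw [← Finset.sum_fiberwise (s := Finset.univ) (g := fun f : κ → ι => Finset.univ.image f),
    Finset.mul_sum]
  rw [← Finset.sum_subset (Finset.subset_univ (Finset.univ.powersetCard (Fintype.card κ)))]
  · refine Finset.sum_congr rfl fun S hS => ?_
    have hS := (Finset.mem_powersetCard.mp hS).2
    rw [← card_filter_image_eq S hS, ← nsmul_eq_mul]
    refine Finset.sum_eq_card_nsmul fun f hf => ?_
    have hf : Finset.univ.image f = S := by simpa using hf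
    have hmem : ∀ k, f k ∈ S := fun k => hf ▸ Finset.mem_image_of_mem f (Finset.mem_univ k)
    have hb : Function.Bijective fun k => (⟨f k, hmem k⟩ : S) := by
      refine (Fintype.bijective_iff_surjective_and_card _).mpr ⟨?_, by simp [hS]⟩
      rintro ⟨x, hx⟩
      rw [← hf] at hx
      obtain ⟨k, -, rfl⟩ := Finset.mem_image.mp hx
      exact ⟨k, rfl⟩
    rw [← Matrix.det_submatrix_equiv_self (Equiv.ofBijective _ hb)]
    rfl
  · intro S _ hS
    refine Finset.sum_eq_zero fun f hf => ?_
    have hf : Finset.univ.image f = S := by simpa using hf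
    have : ¬ Function.Injective f := fun h => hS (by
      simp [Finset.mem_powersetCard, ← hf, Finset.card_image_of_injective _ h])
    obtain ⟨a, b, hab, hne⟩ := Function.not_injective_iff.mp this
    exact Matrix.det_zero_of_row_eq hne (by ext k; simp [hab])

end TensorPower

/-! ### Elementary symmetric functions as traces -/

theorem eigenEsymm_eq_sum_minors {n j : ℕ} (hj : j ≤ n) (M : Matrix (Fin n) (Fin n) ℂ) :
    eigenEsymm j M = ∑ S ∈ Finset.univ.powersetCard j,
      (M.submatrix (Subtype.val : S → Fin n) (Subtype.val : S → Fin n)).det := by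
  have h := M.charpoly_coeff_eq_sum_minors j (by simpa using hj)
  rw [Polynomial.coeff_eq_esymm_roots_of_splits (IsAlgClosed.splits _) (by simp),
    M.charpoly_monic.leadingCoeff] at h
  simp only [Matrix.charpoly_natDegree_eq_dim, Fintype.card_fin, one_mul,
    Nat.sub_sub_self hj] at h
  exact mul_left_cancel₀ (pow_ne_zero _ (by norm_num)) h

theorem eigenEsymm_eq_trace {n j : ℕ} (hj : j ≤ n) (M : Matrix (Fin n) (Fin n) ℂ) :
    eigenEsymm j M = (antisymmetrizer (Fin n) (Fin j) * tensorProd fun _ => M).trace := by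
  rw [trace_antisymmetrizer_mul_tensorProd, sum_det_submatrix_eq, ← mul_assoc,
    inv_mul_cancel₀ (by positivity), one_mul, eigenEsymm_eq_sum_minors hj, Fintype.card_fin]

/-! ### Compression to the exterior power -/

section Compression

open Matrix

/-- A Hermitian idempotent is `V Vᴴ` for an isometry `V`. -/
theorem Matrix.IsHermitian.exists_isometry_of_isIdempotentElem {ι : Type*} [Fintype ι]
    [DecidableEq ι] {P : Matrix ι ι ℂ} (hP : P.IsHermitian) (hI : IsIdempotentElem P) :
    ∃ (m : ℕ) (V : Matrix ι (Fin m) ℂ), Vᴴ * V = 1 ∧ V * Vᴴ = P := by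
  set U : Matrix ι ι ℂ := (hP.eigenvectorUnitary : Matrix ι ι ℂ)
  set d : ι → ℂ := RCLike.ofReal ∘ hP.eigenvalues
  have hUU : Uᴴ * U = 1 := Unitary.coe_star_mul_self hP.eigenvectorUnitary
  have hspec : P = U * diagonal d * Uᴴ := by
    conv_lhs => rw [hP.spectral_theorem, Unitary.conjStarAlgAut_apply]
    rfl
  have hdiag : Uᴴ * P * U = diagonal d := by
    rw [hspec]
    calc Uᴴ * (U * diagonal d * Uᴴ) * U = (Uᴴ * U) * diagonal d * (Uᴴ * U) := by
          simp only [Matrix.mul_assoc]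
      _ = _ := by rw [hUU, Matrix.one_mul, Matrix.mul_one]
  have hsq : ∀ i, d i * d i = d i := by
    have h2 : diagonal d * diagonal d = diagonal d := by
      rw [← hdiag]
      calc Uᴴ * P * U * (Uᴴ * P * U) = Uᴴ * P * (U * Uᴴ) * P * U := by
            simp only [Matrix.mul_assoc]
        _ = Uᴴ * (P * P) * U := by
            rw [mul_eq_one_comm.mp hUU, Matrix.mul_one]; simp only [Matrix.mul_assoc]
        _ = _ := by rw [hI.eq]
    intro i
    simpa [diagonal_mul_diagonal] using congrFun (congrFun h2 i) i
  have h01 : ∀ i, d i = if d i = 1 then 1 else 0 := fun i => by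
    split_ifs with h
    · exact h
    · have := hsq i
      rw [← sub_eq_zero, ← mul_sub_one, mul_eq_zero, sub_eq_zero] at this
      exact this.resolve_right h
  classical
  let e := Fintype.equivFin {i // d i = 1}
  -- The columns of V are the eigenvectors with eigenvalue 1.
  refine ⟨_, U.submatrix id fun a => (e.symm a : ι), ?_, ?_⟩
  · rw [conjTranspose_submatrix, ← submatrix_mul _ _ _ _ _ Function.bijective_id, hUU]
    ext a b
    simp [Matrix.one_apply, Subtype.val_inj]
  · rw [hspec]
    ext a b
    rw [Matrix.mul_apply, ← Equiv.sum_comp e, Matrix.mul_apply]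
    simp only [submatrix_apply, conjTranspose_apply, mul_diagonal, id, Equiv.symm_apply_apply]
    have h : ∀ i, U a i * d i * star (U b i) =
        if d i = 1 then U a i * star (U b i) else 0 := fun i => by
      have hi := h01 i
      split_ifs at hi ⊢ <;> simp [hi]
    simp only [h]
    rw [← Finset.sum_filter, Finset.sum_subtype (p := fun i => d i = 1) _ (by simp)]

-- Since X commutes with V Vᴴ, the map Y ↦ Vᴴ Y V respects powers of X; being continuous and
-- additive, it passes through the exponential series.
open scoped Matrix.Norms.Operator in
theorem exp_compression {ι κ : Type*} [Fintype ι] [DecidableEq ι] [Fintype κ] [DecidableEq κ]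
    {V : Matrix ι κ ℂ} (hV : Vᴴ * V = 1) {X : Matrix ι ι ℂ} (hX : Commute (V * Vᴴ) X) :
    NormedSpace.exp (Vᴴ * X * V) = Vᴴ * NormedSpace.exp X * V := by
  have hpow : ∀ k : ℕ, (Vᴴ * X * V) ^ k = Vᴴ * X ^ k * V := fun k => by
    induction k with
    | zero => simp [hV]
    | succ k ih =>
      rw [pow_succ, ih, pow_succ]
      calc Vᴴ * X ^ k * V * (Vᴴ * X * V) = Vᴴ * X ^ k * (V * Vᴴ * X) * V := by
            simp only [Matrix.mul_assoc]
        _ = Vᴴ * X ^ k * (X * V * (Vᴴ * V)) := by rw [hX.eq]; simp only [Matrix.mul_assoc]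
        _ = _ := by rw [hV, Matrix.mul_one]; simp only [Matrix.mul_assoc]
  have h1 := NormedSpace.exp_series_hasSum_exp' (𝕂 := ℂ) (Vᴴ * X * V)
  have h2 := NormedSpace.exp_series_hasSum_exp' (𝕂 := ℂ) X
  let L : Matrix ι ι ℂ →+ Matrix κ κ ℂ :=
    { toFun := fun Y => Vᴴ * Y * V
      map_zero' := by simp
      map_add' := by simp [Matrix.mul_add, Matrix.add_mul] }
  have hL : Continuous L :=
    ((continuous_const (y := Vᴴ)).matrix_mul continuous_id).matrix_mul continuous_const
  refine h1.unique ?_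
  have h3 : (fun k : ℕ => (k.factorial : ℂ)⁻¹ • (Vᴴ * X * V) ^ k) =
      L ∘ fun k : ℕ => (k.factorial : ℂ)⁻¹ • X ^ k := by
    ext1 k
    simp [L, hpow]
  rw [h3]
  exact h2.map L hL

/-- The `j`-th compound representation `C` (the action on the `j`-th exterior power) and its
derivative `D`. -/
theorem exists_compound (n j : ℕ) (hj : j ≤ n) :
    ∃ (m : ℕ) (C : Matrix (Fin n) (Fin n) ℂ →* Matrix (Fin m) (Fin m) ℂ)
      (D : Matrix (Fin n) (Fin n) ℂ →ₗ[ℂ] Matrix (Fin m) (Fin m) ℂ),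
      (∀ M, (C M).trace = eigenEsymm j M) ∧ (∀ M, C (NormedSpace.exp M) = NormedSpace.exp (D M)) ∧
      (∀ M, M.PosSemidef → (C M).PosSemidef) ∧ (∀ M, M.IsHermitian → (D M).IsHermitian) ∧
      (∀ M, M.PosSemidef → (D M).PosSemidef) := by
  obtain ⟨m, V, hV, hP⟩ := (isHermitian_antisymmetrizer (ι := Fin n)
    (κ := Fin j)).exists_isometry_of_isIdempotentElem isIdempotentElem_antisymmetrizer
  refine ⟨m,
    { toFun := fun M => Vᴴ * (tensorProd fun _ : Fin j => M) * V
      map_one' := ?_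
      map_mul' := fun M N => ?_ },
    { toFun := fun M => Vᴴ * tensorDeriv (Fin n) (Fin j) M * V
      map_add' := fun M N => by simp [Matrix.mul_add, Matrix.add_mul]
      map_smul' := fun c M => by simp }, fun M => ?_, fun M => ?_, fun M hM => ?_, fun M hM => ?_,
      fun M hM => ?_⟩
  · have : (tensorProd fun _ : Fin j => (1 : Matrix (Fin n) (Fin n) ℂ)) = 1 := tensorProd_one
    rw [this, Matrix.mul_one, hV]
  · have : (tensorProd fun _ : Fin j => M * N) =
        (tensorProd fun _ : Fin j => M) * tensorProd fun _ : Fin j => N :=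
      tensorProd_mul (fun _ => M) fun _ => N
    rw [this]
    -- Multiplicativity: P = V Vᴴ is inserted on the left at no cost and moved between the two
    -- factors.
    have hc := (antisymmetrizer_commute_tensorProd (κ := Fin j) M).eq
    rw [← hP] at hc
    calc _ = (Vᴴ * V) * Vᴴ * (tensorProd fun _ : Fin j => M) *
          (tensorProd fun _ : Fin j => N) * V := by
          rw [hV, Matrix.one_mul]; simp only [Matrix.mul_assoc]
      _ = Vᴴ * (V * Vᴴ * (tensorProd fun _ : Fin j => M)) *
          (tensorProd fun _ : Fin j => N) * V := by simp only [Matrix.mul_assoc]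
      _ = _ := by rw [hc]; simp only [Matrix.mul_assoc]
  · change (Vᴴ * (tensorProd fun _ : Fin j => M) * V).trace = _
    rw [eigenEsymm_eq_trace hj, Matrix.trace_mul_comm, ← Matrix.mul_assoc, hP]
  · change Vᴴ * (tensorProd fun _ : Fin j => NormedSpace.exp M) * V =
      NormedSpace.exp (Vᴴ * tensorDeriv (Fin n) (Fin j) M * V)
    rw [exp_compression hV (hP ▸ antisymmetrizer_commute_tensorDeriv M), exp_tensorDeriv]
  · exact (posSemidef_tensorProd hM).conjTranspose_mul_mul_same V
  · exact isHermitian_conjTranspose_mul_mul V (isHermitian_tensorDeriv hM)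
  · exact (posSemidef_tensorDeriv hM).conjTranspose_mul_mul_same V

end Compression

/-! ### Dyson expansion and simplex integrals -/

section Dyson

open NormedSpace Set

set_option linter.unusedSectionVars false

variable {𝔸 : Type*} [NormedRing 𝔸] [NormedAlgebra ℝ 𝔸] [CompleteSpace 𝔸]

theorem continuous_exp_smul (A : 𝔸) : Continuous fun t : ℝ => exp (t • A) :=
  continuous_iff_continuousAt.mpr fun t => (hasDerivAt_exp_smul_const (𝕂 := ℝ) A t).continuousAt

theorem continuous_exp_real : Continuous (exp : 𝔸 → 𝔸) := by
  let : NormedAlgebra ℚ 𝔸 := NormedAlgebra.restrictScalars ℚ ℝ 𝔸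
  exact exp_continuous

/-- The terms of the Dyson expansion of `exp (t (A + x B))` in powers of `x`. -/
noncomputable def dysonTerm (A B : 𝔸) : ℕ → ℝ → 𝔸
  | 0, t => exp (t • A)
  | k + 1, t => ∫ s in (0 : ℝ)..t, exp (s • A) * (B * dysonTerm A B k (t - s))

theorem continuous_dysonTerm (A B : 𝔸) (k : ℕ) : Continuous (dysonTerm A B k) := by
  induction k with
  | zero => exact continuous_exp_smul A
  | succ k ih =>
    refine intervalIntegral.continuous_parametric_intervalIntegral_of_continuous
      (f := fun t s => exp (s • A) * (B * dysonTerm A B k (t - s))) ?_ continuous_id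
    exact ((continuous_exp_smul A).comp continuous_snd).mul
      (continuous_const.mul (ih.comp (continuous_fst.sub continuous_snd)))

/-- Duhamel's formula. -/
theorem exp_smul_add_eq (A C : 𝔸) (t : ℝ) :
    exp (t • (A + C)) = exp (t • A) +
      ∫ s in (0 : ℝ)..t, exp (s • A) * (C * exp ((t - s) • (A + C))) := by
  -- The path s ↦ e^{sA} e^{(t-s)(A+C)} joins e^{t(A+C)} to e^{tA}.
  have hd : ∀ s ∈ uIcc 0 t, HasDerivAt (fun s : ℝ => exp (s • A) * exp ((t - s) • (A + C)))
      (-(exp (s • A) * (C * exp ((t - s) • (A + C))))) s := fun s _ => by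
    have h1 := hasDerivAt_exp_smul_const (𝕂 := ℝ) A s
    have h2 := (hasDerivAt_exp_smul_const' (𝕂 := ℝ) (A + C) (t - s)).scomp s
      ((hasDerivAt_id s).const_sub t)
    refine (h1.mul h2).congr_deriv ?_
    simp only [Function.comp_apply, neg_smul, one_smul]
    noncomm_ring
  have hc : Continuous fun s : ℝ => exp (s • A) * (C * exp ((t - s) • (A + C))) :=
    (continuous_exp_smul A).mul (continuous_const.mul
      ((continuous_exp_smul (A + C)).comp (continuous_const.sub continuous_id)))
  have h := intervalIntegral.integral_eq_sub_of_hasDerivAt hd (hc.neg.intervalIntegrable _ _)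
  rw [intervalIntegral.integral_neg, sub_self, zero_smul, exp_zero, zero_smul, exp_zero, sub_zero,
    mul_one, one_mul, neg_eq_iff_eq_neg] at h
  rw [h]
  abel

/-- Remainder of the Dyson expansion. -/
theorem norm_exp_sub_sum_dysonTerm_le (A B : 𝔸) (K : ℕ) :
    ∃ C : ℝ, ∀ t ∈ Icc (0 : ℝ) 1, ∀ x ∈ Icc (-1 : ℝ) 1,
      ‖exp (t • (A + x • B)) - ∑ k ∈ Finset.range K, x ^ k • dysonTerm A B k t‖ ≤ C * |x| ^ K := by
  induction K with
  | zero =>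
    have hc : Continuous fun p : ℝ × ℝ => exp (p.1 • (A + p.2 • B)) :=
      continuous_exp_real.comp (by fun_prop)
    obtain ⟨C, hC⟩ := (isCompact_Icc.prod isCompact_Icc).exists_bound_of_continuousOn
      (s := Icc (0 : ℝ) 1 ×ˢ Icc (-1 : ℝ) 1) hc.continuousOn
    exact ⟨C, fun t ht x hx => by simpa using hC (t, x) ⟨ht, hx⟩⟩
  | succ K ih =>
    obtain ⟨C, hC⟩ := ih
    obtain ⟨a, ha⟩ := isCompact_Icc.exists_bound_of_continuousOn
      (s := Icc (0 : ℝ) 1) (continuous_exp_smul A).continuousOn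
    refine ⟨a * (‖B‖ * C), fun t ht x hx => ?_⟩
    have ha0 : 0 ≤ a := (norm_nonneg _).trans (ha 0 (by simp))
    set R : ℝ → 𝔸 := fun t =>
      exp (t • (A + x • B)) - ∑ k ∈ Finset.range K, x ^ k • dysonTerm A B k t with hR
    have hcont : ∀ f : ℝ → 𝔸, Continuous f →
        IntervalIntegrable (fun s => exp (s • A) * (B * f (t - s))) volume 0 t := fun f hf =>
      ((continuous_exp_smul A).mul (continuous_const.mul
        (hf.comp (continuous_const.sub continuous_id)))).intervalIntegrable _ _
    -- Duhamel with C = xB expresses the next remainder through R at times t - s, gaining one factor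
    -- x. This is why the bound must be uniform in t.
    have hrec : exp (t • (A + x • B)) - ∑ k ∈ Finset.range (K + 1), x ^ k • dysonTerm A B k t =
        x • ∫ s in (0 : ℝ)..t, exp (s • A) * (B * R (t - s)) := by
      have h1 : ∀ s, exp (s • A) * (B * R (t - s)) =
          exp (s • A) * (B * exp ((t - s) • (A + x • B))) -
          ∑ k ∈ Finset.range K, x ^ k • (exp (s • A) * (B * dysonTerm A B k (t - s))) := fun s => by
        simp only [hR, mul_sub, Finset.mul_sum, mul_smul_comm]
      have hi : ∀ k ∈ Finset.range K, IntervalIntegrable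
          (fun s => x ^ k • (exp (s • A) * (B * dysonTerm A B k (t - s)))) volume 0 t := fun k _ => by
        simpa only using! (hcont _ (continuous_dysonTerm A B k)).smul (x ^ k)
      have hi' : IntervalIntegrable (fun s => ∑ k ∈ Finset.range K,
          x ^ k • (exp (s • A) * (B * dysonTerm A B k (t - s)))) volume 0 t := by
        simpa only [Finset.sum_fn] using! IntervalIntegrable.sum _ hi
      simp only [h1]
      rw [intervalIntegral.integral_sub (hcont _ (continuous_exp_smul _)) hi',
        intervalIntegral.integral_finsetSum hi]
      simp only [intervalIntegral.integral_smul]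
      rw [exp_smul_add_eq, Finset.sum_range_succ', smul_sub, Finset.smul_sum,
        ← intervalIntegral.integral_smul]
      simp only [smul_smul, ← pow_succ', pow_zero, one_smul, dysonTerm, smul_mul_assoc,
        mul_smul_comm]
      abel
    rw [hrec, norm_smul, Real.norm_eq_abs, pow_succ]
    have hb : ‖∫ s in (0 : ℝ)..t, exp (s • A) * (B * R (t - s))‖ ≤
        a * (‖B‖ * (C * |x| ^ K)) * |t - 0| := by
      refine intervalIntegral.norm_integral_le_of_norm_le_const fun s hs => ?_
      rw [uIoc_of_le ht.1] at hs
      refine (norm_mul_le _ _).trans (mul_le_mul (ha s ⟨hs.1.le, hs.2.trans ht.2⟩)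
        ((norm_mul_le _ _).trans (mul_le_mul_of_nonneg_left
          (hC (t - s) ⟨by linarith [hs.2], by linarith [hs.1, ht.2]⟩ x hx) (norm_nonneg _)))
        (norm_nonneg _) ha0)
    have hC0 : 0 ≤ C * |x| ^ K := (norm_nonneg _).trans (hC t ht x hx)
    have ht1 : |t - 0| ≤ 1 := by rw [sub_zero, abs_of_nonneg ht.1]; exact ht.2
    have h2 : a * (‖B‖ * (C * |x| ^ K)) * |t - 0| ≤ a * (‖B‖ * (C * |x| ^ K)) :=
      mul_le_of_le_one_right (by positivity) ht1
    calc _ ≤ |x| * (a * (‖B‖ * (C * |x| ^ K))) :=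
          mul_le_mul_of_nonneg_left (hb.trans h2) (abs_nonneg x)
      _ = _ := by ring

/-- The word `e^{s₀ A} B e^{s₁ A} B ⋯ B e^{s_k A}` in a Banach algebra. -/
noncomputable def algWord {k : ℕ} (A B : 𝔸) (s : Fin (k + 1) → ℝ) : 𝔸 :=
  exp (s 0 • A) * (List.ofFn fun i : Fin k => B * exp (s i.succ • A)).prod

theorem algWord_succ {k : ℕ} (A B : 𝔸) (s : Fin (k + 2) → ℝ) :
    algWord A B s = exp (s 0 • A) * (B * algWord A B (Fin.tail s)) := by
  simp [algWord, List.ofFn_succ, mul_assoc, Fin.tail]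

theorem continuous_algWord {k : ℕ} (A B : 𝔸) :
    Continuous fun s : Fin (k + 1) → ℝ => algWord A B s := by
  induction k with
  | zero =>
    simp only [algWord, List.ofFn_zero, List.prod_nil, mul_one]
    exact (continuous_exp_smul A).comp (continuous_apply 0)
  | succ k ih =>
    simp only [algWord_succ]
    exact ((continuous_exp_smul A).comp (continuous_apply 0)).mul (continuous_const.mul
      (ih.comp (continuous_pi fun i => continuous_apply _)))

/-- The simplex `{s | 0 ≤ sᵢ, ∑ sᵢ ≤ t}`. -/
def scaledSimplex (k : ℕ) (t : ℝ) : Set (Fin k → ℝ) :=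
  {s | (∀ i, 0 ≤ s i) ∧ ∑ i, s i ≤ t}

/-- The point with first coordinates `s` and coordinate sum `t`. -/
def scaledPoint {k : ℕ} (t : ℝ) (s : Fin k → ℝ) : Fin (k + 1) → ℝ :=
  Fin.snoc (α := fun _ => ℝ) s (t - ∑ i, s i)

theorem isCompact_scaledSimplex (k : ℕ) (t : ℝ) : IsCompact (scaledSimplex k t) := by
  refine (isCompact_Icc (a := (0 : Fin k → ℝ)) (b := fun _ => t)).of_isClosed_subset ?_ ?_
  · exact (isClosed_le continuous_const continuous_id).inter (isClosed_le
      (continuous_finsetSum _ fun i _ => continuous_apply i) continuous_const)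
  · intro s hs
    exact ⟨hs.1, fun i =>
      (Finset.single_le_sum (fun j _ => hs.1 j) (Finset.mem_univ i)).trans hs.2⟩

theorem continuous_scaledPoint {k : ℕ} (t : ℝ) :
    Continuous fun s : Fin k → ℝ => scaledPoint t s := by
  refine continuous_pi fun i => ?_
  refine Fin.lastCases ?_ (fun i => ?_) i
  · simp only [scaledPoint, Fin.snoc_last]
    fun_prop
  · simp only [scaledPoint, Fin.snoc_castSucc]
    fun_prop

theorem scaledPoint_cons {k : ℕ} (t a : ℝ) (s : Fin k → ℝ) :
    scaledPoint t (Fin.cons a s : Fin (k + 1) → ℝ) = Fin.cons a (scaledPoint (t - a) s) := by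
  rw [scaledPoint, scaledPoint, Fin.cons_snoc_eq_snoc_cons, Fin.sum_cons, sub_sub]

theorem cons_mem_scaledSimplex {k : ℕ} (t a : ℝ) (s : Fin k → ℝ) :
    (Fin.cons a s : Fin (k + 1) → ℝ) ∈ scaledSimplex (k + 1) t ↔
      0 ≤ a ∧ s ∈ scaledSimplex k (t - a) := by
  simp only [scaledSimplex, mem_ofPred_eq, Fin.forall_fin_succ, Fin.cons_zero, Fin.cons_succ,
    Fin.sum_cons, and_assoc, le_sub_iff_add_le']

theorem integrableOn_algWord (A B : 𝔸) (k : ℕ) (t : ℝ) :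
    IntegrableOn (fun s => algWord A B (scaledPoint t s)) (scaledSimplex k t) :=
  ((continuous_algWord A B).comp (continuous_scaledPoint t)).continuousOn.integrableOn_compact
    (isCompact_scaledSimplex k t)

/-- Slicing at first coordinate a leaves the simplex of size t - a, and the word splits off e^{aA}
B; Fubini then reproduces the recursion of `dysonTerm`. The shrinking size forces general t. -/
theorem setIntegral_algWord_eq_dysonTerm (A B : 𝔸) (k : ℕ) {t : ℝ} (ht : 0 ≤ t) :
    ∫ s in scaledSimplex k t, algWord A B (scaledPoint t s) = dysonTerm A B k t := by
  induction k generalizing t with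
  | zero =>
    have hs : scaledSimplex 0 t = univ := by ext; simp [scaledSimplex, ht]
    -- In dimension zero the volume is a unit point mass.
    rw [hs, Measure.restrict_univ, Measure.volume_pi_eq_dirac, integral_dirac]
    simp [algWord, scaledPoint, dysonTerm, Fin.snoc]
  | succ k ih =>
    have hm := (isCompact_scaledSimplex (k + 1) t).measurableSet
    have hmp := (volume_preserving_piFinSuccAbove (fun _ : Fin (k + 1) => ℝ) 0).symm
    have hint := (integrable_indicator_iff hm).mpr (integrableOn_algWord A B (k + 1) t)
    rw [← integral_indicator hm, ← hmp.integral_comp' (g := indicator _ _)]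
    have hint' := (hmp.integrable_comp_emb (MeasurableEquiv.measurableEmbedding _)).mpr hint
    rw [Measure.volume_eq_prod] at hint' ⊢
    have hprod := integral_prod _ hint'
    simp only [Function.comp_apply] at hprod
    rw [hprod, dysonTerm, intervalIntegral.integral_of_le ht,
      ← integral_Icc_eq_integral_Ioc, ← integral_indicator measurableSet_Icc]
    congr 1
    ext1 a
    have hval : ∀ s : Fin k → ℝ, (scaledSimplex (k + 1) t).indicator
        (fun s => algWord A B (scaledPoint t s))
        ((MeasurableEquiv.piFinSuccAbove (fun _ : Fin (k + 1) => ℝ) 0).symm (a, s)) =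
        if 0 ≤ a then (scaledSimplex k (t - a)).indicator
          (fun s => exp (a • A) * (B * algWord A B (scaledPoint (t - a) s))) s else 0 := fun s => by
      have he : (MeasurableEquiv.piFinSuccAbove (fun _ : Fin (k + 1) => ℝ) 0).symm (a, s) =
        (Fin.cons a s : Fin (k + 1) → ℝ) := by
          simp [MeasurableEquiv.piFinSuccAbove, Fin.consEquiv]
      rw [he]
      have hmem := cons_mem_scaledSimplex t a s
      simp only [indicator, scaledPoint_cons, algWord_succ, Fin.cons_zero, Fin.tail_cons]
      split_ifs <;> first | rfl | (exfalso; tauto)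
    simp only [hval]
    by_cases ha : a ∈ Icc 0 t
    · simp only [if_pos ha.1, indicator_of_mem ha]
      rw [integral_indicator (isCompact_scaledSimplex k _).measurableSet,
        ← ih (sub_nonneg.mpr ha.2)]
      have hi := integrableOn_algWord A B k (t - a)
      rw [integral_const_mul_of_integrable, integral_const_mul_of_integrable hi]
      exact hi.const_mul B
    · rw [indicator_of_notMem ha]
      by_cases h0 : 0 ≤ a
      · have hE : scaledSimplex k (t - a) = ∅ := by
          ext s
          simp only [scaledSimplex, mem_ofPred_eq, mem_empty_iff_false, iff_false, not_and, not_le]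
          intro hs
          have : t < a := not_le.mp fun h => ha ⟨h0, h⟩
          exact (sub_neg.mpr this).trans_le (Finset.sum_nonneg fun i _ => hs i)
        simp [hE]
      · simp [h0]

end Dyson

/-! ### Moments and Taylor coefficients of Laplace transforms -/

section Laplace

open Set

theorem ae_nonneg_of_Iio_null {μ : Measure ℝ} (hμ : μ (Iio 0) = 0) : ∀ᵐ t ∂μ, 0 ≤ t := by
  rw [ae_iff]
  simpa only [not_le] using! hμ

theorem integrable_pow_of_integrable_exp {μ : Measure ℝ} (hμ : μ (Iio 0) = 0)
    (hexp : ∀ l : ℝ, Integrable (fun t : ℝ => Real.exp (-(l * t))) μ) (k : ℕ) :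
    Integrable (fun t : ℝ => t ^ k) μ := by
  refine ((hexp (-1)).const_mul (k.factorial : ℝ)).mono'
    (continuous_pow k).aestronglyMeasurable ?_
  filter_upwards [ae_nonneg_of_Iio_null hμ] with t ht
  have := Real.pow_div_factorial_le_exp t ht k
  rw [div_le_iff₀ (by positivity)] at this
  rw [Real.norm_of_nonneg (by positivity)]
  simpa [mul_comm] using this

/-- Taylor expansion of a Laplace transform at `0`, with remainder bound. -/
theorem norm_integral_exp_sub_sum_moments_le {μ : Measure ℝ} (hμ : μ (Iio 0) = 0)
    (hexp : ∀ l : ℝ, Integrable (fun t : ℝ => Real.exp (-(l * t))) μ) (K : ℕ) :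
    ∃ C : ℝ, ∀ x ∈ Icc (-1 : ℝ) 1, ‖∫ t, Real.exp (x * t) ∂μ -
      ∑ k ∈ Finset.range K, x ^ k * ((∫ t, t ^ k ∂μ) / k.factorial)‖ ≤ C * |x| ^ K := by
  -- For |x| ≤ 1 and t ≥ 0 the remainder is at most |x|^K t^K e^t, and t^K ≤ K! e^t supplies the
  -- second exponential.
  refine ⟨K.factorial * ∫ t, Real.exp (-(-2 * t)) ∂μ, fun x hx => ?_⟩
  have hi : ∀ k ∈ Finset.range K, Integrable (fun t : ℝ => (x * t) ^ k / k.factorial) μ :=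
    fun k _ => by
      simp only [mul_pow]
      exact ((integrable_pow_of_integrable_exp hμ hexp k).const_mul _).div_const _
  have hx' : Integrable (fun t : ℝ => Real.exp (x * t)) μ := by simpa using hexp (-x)
  have heq : ∫ t, Real.exp (x * t) ∂μ -
      ∑ k ∈ Finset.range K, x ^ k * ((∫ t, t ^ k ∂μ) / k.factorial) =
      ∫ t, (Real.exp (x * t) - ∑ k ∈ Finset.range K, (x * t) ^ k / k.factorial) ∂μ := by
    rw [integral_sub hx' (integrable_finsetSum _ hi), integral_finsetSum _ hi]
    congr 1
    refine Finset.sum_congr rfl fun k _ => ?_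
    simp only [mul_pow]
    rw [integral_div, integral_const_mul, mul_div_assoc]
  have hrhs : (K.factorial * ∫ t, Real.exp (-(-2 * t)) ∂μ) * |x| ^ K =
      ∫ t, |x| ^ K * (K.factorial * Real.exp (-(-2 * t))) ∂μ := by
    rw [integral_const_mul, integral_const_mul, mul_comm]
  rw [heq, hrhs]
  refine norm_integral_le_of_norm_le (((hexp (-2)).const_mul _).const_mul _) ?_
  filter_upwards [ae_nonneg_of_Iio_null hμ] with t ht
  have h1 : ‖Real.exp (x * t) - ∑ k ∈ Finset.range K, (x * t) ^ k / k.factorial‖ ≤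
      ‖x * t‖ ^ K * Real.exp ‖x * t‖ := by
    have := Complex.norm_exp_sub_sum_le_norm_mul_exp ((x * t : ℝ) : ℂ) K
    rw [Complex.norm_real] at this
    refine le_trans (le_of_eq ?_) this
    rw [← Complex.norm_real]
    push_cast
    rfl
  have hxt : ‖x * t‖ ≤ t := by
    rw [norm_mul, Real.norm_of_nonneg ht]
    exact mul_le_of_le_one_left ht (abs_le.mpr hx)
  have h2 : t ^ K ≤ K.factorial * Real.exp t := by
    have := Real.pow_div_factorial_le_exp t ht K
    rwa [div_le_iff₀ (by positivity), mul_comm] at this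
  refine h1.trans ?_
  calc ‖x * t‖ ^ K * Real.exp ‖x * t‖ ≤ ‖x * t‖ ^ K * Real.exp t := by gcongr
    _ = |x| ^ K * (t ^ K * Real.exp t) := by
        rw [norm_mul, Real.norm_of_nonneg ht, mul_pow, Real.norm_eq_abs, mul_assoc]
    _ ≤ |x| ^ K * (K.factorial * Real.exp t * Real.exp t) := by gcongr
    _ = _ := by rw [mul_assoc, ← Real.exp_add]; ring_nf

/-- A formal power series all of whose truncations are small to the order of truncation is zero. -/
theorem eq_zero_of_forall_norm_sum_le {a : ℕ → ℂ}
    (h : ∀ K, ∃ C : ℝ, ∀ x ∈ Icc (-1 : ℝ) 1,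
      ‖∑ k ∈ Finset.range K, (x : ℂ) ^ k * a k‖ ≤ C * |x| ^ K) (k : ℕ) : a k = 0 := by
  induction k using Nat.strong_induction_on with
  | _ k ih =>
    obtain ⟨C, hC⟩ := h (k + 1)
    -- With the lower coefficients zero, the bound of order k + 1 is divided by x^k.
    have hb : ∀ᶠ x in nhdsWithin (0 : ℝ) (Ioi 0), ‖a k‖ ≤ C * x := by
      filter_upwards [Ioo_mem_nhdsGT (show (0 : ℝ) < 1 by norm_num)] with x hx
      have := hC x ⟨by linarith [hx.1], hx.2.le⟩
      rw [Finset.sum_range_succ, Finset.sum_eq_zero fun i hi => by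
        rw [ih i (Finset.mem_range.mp hi), mul_zero], zero_add, norm_mul, norm_pow,
        Complex.norm_real, Real.norm_eq_abs, abs_of_pos hx.1, pow_succ] at this
      have hp : 0 < x ^ k := pow_pos hx.1 k
      refine le_of_mul_le_mul_left ?_ hp
      linarith
    have ht : Filter.Tendsto (fun x : ℝ => C * x) (nhdsWithin 0 (Ioi 0)) (nhds (C * 0)) :=
      ((continuous_const.mul continuous_id).tendsto 0).mono_left nhdsWithin_le_nhds
    have := ge_of_tendsto ht hb
    rw [mul_zero] at this
    exact norm_le_zero_iff.mp this

end Laplace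

/-! ### Nonnegativity of the simplex integrals and the theorem -/

section Main

section BanachAlgebra

variable {𝔸 : Type*} [NormedRing 𝔸] [NormedAlgebra ℝ 𝔸] [CompleteSpace 𝔸]

/-- If `l ↦ L (exp (A - l B))` is a Laplace transform, then `L` is nonnegative on the Dyson terms,
which are its Taylor coefficients at `0` up to sign. -/
theorem map_dysonTerm_nonneg (L : 𝔸 →L[ℝ] ℂ) {A B : 𝔸}
    (h : IsLaplaceTransform fun l : ℝ => L (NormedSpace.exp (A - l • B))) (k : ℕ) :
    0 ≤ L (dysonTerm A B k 1) := by
  obtain ⟨μ, hμ, hF⟩ := h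
  have hexp := fun l => (hF l).1
  -- With x = -l, the Dyson and moment expansions describe the same function, so their coefficients
  -- agree.
  have hk : L (dysonTerm A B k 1) - (((∫ t, t ^ k ∂μ) / k.factorial : ℝ) : ℂ) = 0 := by
    refine eq_zero_of_forall_norm_sum_le (a := fun k =>
      L (dysonTerm A B k 1) - (((∫ t, t ^ k ∂μ) / k.factorial : ℝ) : ℂ)) (fun K => ?_) k
    obtain ⟨C₁, h₁⟩ := norm_exp_sub_sum_dysonTerm_le A B K
    obtain ⟨C₂, h₂⟩ := norm_integral_exp_sub_sum_moments_le hμ hexp K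
    refine ⟨‖L‖ * C₁ + C₂, fun x hx => ?_⟩
    have h₁ := L.le_opNorm_of_le (h₁ 1 (by simp) x hx)
    have h₂ := h₂ x hx
    have hval : L (NormedSpace.exp (A + x • B)) = ((∫ t, Real.exp (x * t) ∂μ : ℝ) : ℂ) := by
      have := (hF (-x)).2
      simpa using this
    rw [one_smul, map_sub, map_sum, hval] at h₁
    simp only [map_smul] at h₁
    rw [← Complex.norm_real] at h₂
    have hsum : ∑ k ∈ Finset.range K, (x : ℂ) ^ k *
        (L (dysonTerm A B k 1) - (((∫ t, t ^ k ∂μ) / k.factorial : ℝ) : ℂ)) =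
        ((∫ t, Real.exp (x * t) ∂μ - ∑ k ∈ Finset.range K,
          x ^ k * ((∫ t, t ^ k ∂μ) / k.factorial) : ℝ) : ℂ) -
        (((∫ t, Real.exp (x * t) ∂μ : ℝ) : ℂ) -
          ∑ k ∈ Finset.range K, x ^ k • L (dysonTerm A B k 1)) := by
      simp only [mul_sub, Finset.sum_sub_distrib, Complex.real_smul]
      push_cast
      ring
    rw [hsum]
    refine (norm_sub_le _ _).trans ((add_le_add h₂ h₁).trans (le_of_eq ?_))
    ring
  rw [sub_eq_zero.mp hk, Complex.zero_le_real]
  refine div_nonneg (integral_nonneg_of_ae ?_) (by positivity)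
  filter_upwards [ae_nonneg_of_Iio_null hμ] with t ht
  exact pow_nonneg ht k

theorem map_setIntegral_algWord_nonneg (L : 𝔸 →ₗ[ℝ] ℂ) (hL : Continuous L) {A B : 𝔸}
    (h : IsLaplaceTransform fun l : ℝ => L (NormedSpace.exp (A - l • B))) (k : ℕ) :
    IntegrableOn (fun s : Fin k → ℝ => L (algWord A B (scaledPoint 1 s))) (scaledSimplex k 1) ∧
      0 ≤ ∫ s in scaledSimplex k 1, L (algWord A B (scaledPoint 1 s)) := by
  let L' : 𝔸 →L[ℝ] ℂ := ⟨L, hL⟩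
  refine ⟨L'.integrable_comp (integrableOn_algWord A B k 1), ?_⟩
  have h1 := L'.integral_comp_comm (integrableOn_algWord A B k 1)
  rw [setIntegral_algWord_eq_dysonTerm A B k zero_le_one] at h1
  exact (map_dysonTerm_nonneg L' h k).trans_eq h1.symm

end BanachAlgebra

-- The operator norm serves only to make matrices a Banach algebra; words and simplices agree
-- definitionally with those at t = 1.
open scoped Matrix.Norms.Operator in
theorem setIntegral_trace_expWord_nonneg {m : ℕ} {A B : Matrix (Fin m) (Fin m) ℂ}
    (h : IsLaplaceTransform fun l : ℝ => (NormedSpace.exp (A - l • B)).trace) (k : ℕ) :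
    IntegrableOn (fun s : Fin k → ℝ => (expWord A B (simplexPoint s)).trace) (solidSimplex k) ∧
      0 ≤ ∫ s in solidSimplex k, (expWord A B (simplexPoint s)).trace :=
  map_setIntegral_algWord_nonneg (Matrix.traceLinearMap (Fin m) ℝ ℂ)
    (continuous_id.matrix_trace) h k

theorem map_expWord {n m k : ℕ} (C : Matrix (Fin n) (Fin n) ℂ →* Matrix (Fin m) (Fin m) ℂ)
    (D : Matrix (Fin n) (Fin n) ℂ →ₗ[ℂ] Matrix (Fin m) (Fin m) ℂ)
    (hCD : ∀ M, C (NormedSpace.exp M) = NormedSpace.exp (D M))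
    (A B : Matrix (Fin n) (Fin n) ℂ) (s : Fin (k + 1) → ℝ) :
    C (expWord A B s) = expWord (D A) (C B) s := by
  rw [expWord, expWord, map_mul, map_list_prod, List.map_ofFn, hCD, LinearMap.map_smul_of_tower]
  congr 3
  ext1 i
  rw [Function.comp_apply, map_mul, hCD, LinearMap.map_smul_of_tower]

end Main

theorem theorem4 (hBMV : ∀ m : ℕ, BMVProperty m) :
    (∀ (n : ℕ) (A B : Matrix (Fin n) (Fin n) ℂ), A.IsHermitian → B.PosSemidef →
      ∀ k j : ℕ, 1 ≤ k → 1 ≤ j → j ≤ n →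
        IntegrableOn (fun s : Fin k → ℝ => eigenEsymm j (expWord A B (simplexPoint s)))
          (solidSimplex k) volume ∧
        0 ≤ ∫ s in solidSimplex k, eigenEsymm j (expWord A B (simplexPoint s))) ∧
    (∀ (n : ℕ) (A B : Matrix (Fin n) (Fin n) ℂ), A.IsHermitian → B.PosSemidef →
      ∀ j : ℕ, 1 ≤ j → j ≤ n →
        IsLaplaceTransform fun l : ℝ => eigenEsymm j (NormedSpace.exp (A - l • B))) := by
  refine ⟨fun n A B hA hB k j _ _ hj => ?_, fun n A B hA hB j _ hj => ?_⟩
  · obtain ⟨m, C, D, htr, hexp, hC, hDh, -⟩ := exists_compound n j hj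
    simp only [← htr, map_expWord C D hexp]
    -- In a word B is a factor, hence becomes C(B); in the exponent of part (b) it is a summand and
    -- becomes D(B).
    exact setIntegral_trace_expWord_nonneg (hBMV m _ _ (hDh A hA) (hC B hB)) k
  · obtain ⟨m, C, D, htr, hexp, -, hDh, hDp⟩ := exists_compound n j hj
    simp only [← htr, hexp, map_sub, LinearMap.map_smul_of_tower]
    exact hBMV m _ _ (hDh A hA) (hDp B hB)
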